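/- Let $p$ be an odd prime, $s\ge 1$ an integer, $q=p^s$, and let $\mathbb{F}_q$ be the finite field with $q$ elements. Let $\chi$ be the quadratic character of $\mathbb{F}_q$ (so $\chi(x)=1$ if $x$ is a nonzero square, $\chi(x)=-1$ if $x$ is a nonsquare, $\chi(0)=0$). Let $k\ge 1$ be an integer and let $b\in\mathbb{F}_q$, $b\neq 0$. Write $$\widetilde N^*(k,b)=\#\{(x_1,\dots,x_k)\in(\mathbb{F}_q^*)^k \mid x_1^2+\cdots+x_k^2=b,\ x_i\neq x_j \text{ for all } i\neq j\}$$ and $(x)_k=x(x-1)\cdots(x-k+1)$. For complex numbers $t_1,\dots,t_k$ put $$C_k(t_1,\dots,t_k)=\sum_{\substack{c_1,\dots,c_k\ge 0\\ \sum_i i c_i=k}}\frac{k!}{1^{c_1}c_1!\,2^{c_2}c_2!\cdots k^{c_k}c_k!}\;t_1^{c_1}t_2^{c_2}\cdots t_k^{c_k},$$ and for complex numbers $u,v,w$ put $A_{k,b}(u,v,w)=C_k(t_1,\dots,t_k)$, where, for $1\le i\le k$, $t_i=u$ if $p\nmid i$ and $\chi(i)=\chi(b)$, $t_i=v$ if $p\nmid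 i$ and $\chi(i)=-\chi(b)$, and $t_i=w$ if $p\mid i$ (here $\chi(i)$ is the value of $\chi$ at the image of the integer $i$ in $\mathbb{F}_q$). (1) If either $p\equiv 1 \pmod 4$, or $p\equiv 3\pmod 4$ and $s$ is even, then $$\widetilde N^*(k,b)=\frac{(q-1)_k}{q}-\frac{(-1)^k}{2q}\Big[(1-\sqrt q)\,A_{k,b}(1-\sqrt q,\,1+\sqrt q,\,1-q)+(1+\sqrt q)\,A_{k,b}(1+\sqrt q,\,1-\sqrt q,\,1-q)\Big].$$ (2) If $p\equiv 3\pmod 4$ and $s$ is odd, then, with $i=\sqrt{-1}$, $$\widetilde N^*(k,b)=\frac{(q-1)_k}{q}-\frac{(-1)^k}{2q}\Big[(1+\sqrt q\,i)\,A_{k,b}(1-\sqrt q\,i,\,1+\sqrt q\,i,\,1-q)+(1-\sqrt q\,i)\,A_{k,b}(1+\sqrt q\,i,\,1-\sqrt q\,i,\,1-q)\Big].$$ -/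

import Mathlib

open scoped Nat

noncomputable section

/-- The number of `k`-tuples of pairwise distinct nonzero elements `x₁, …, x_k` of `F` with
`x₁² + ⋯ + x_k² = b`. -/
def distinctNonzeroSquareSols (F : Type*) [Field F] (k : ℕ) (b : F) : ℕ :=
  Nat.card {x : Fin k → F // (∀ i, x i ≠ 0) ∧ Function.Injective x ∧ ∑ i, x i ^ 2 = b}

/-- The finite set of all tuples `(c₁, …, c_k)` of natural numbers with `∑ i, i * c_i = k`.
The entry `c_{j+1}` is stored at `j : Fin k`. (The equation forces `c_i ≤ k`, so the bound on
the entries loses nothing.) -/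
def cycleTypes (k : ℕ) : Finset (Fin k → ℕ) :=
  (Fintype.piFinset fun _ : Fin k => Finset.range (k + 1)).filter
    fun c => ∑ j : Fin k, (j.val + 1) * c j = k

/-- The number `N(c₁, …, c_k) = k! / (1^{c₁} c₁! 2^{c₂} c₂! ⋯ k^{c_k} c_k!)` of permutations in
`S_k` with exactly `c_i` cycles of length `i`, as a complex number. -/
def cycleTypeCount (k : ℕ) (c : Fin k → ℕ) : ℂ :=
  (k ! : ℂ) / ∏ j : Fin k, (((j.val + 1 : ℕ) : ℂ) ^ c j * ((c j)! : ℂ))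

/-- The polynomial
`C_k(t₁, …, t_k) = ∑_{∑ i c_i = k} N(c₁, …, c_k) t₁^{c₁} ⋯ t_k^{c_k}`; here `t i` is `t_i`, for
`1 ≤ i ≤ k`. -/
def cyclePoly (k : ℕ) (t : ℕ → ℂ) : ℂ :=
  ∑ c ∈ cycleTypes k, cycleTypeCount k c * ∏ j : Fin k, t (j.val + 1) ^ c j

/-- `A_{k,b}(u, v, w) = C_k(t₁, …, t_k)` where, with `p` the characteristic of `F` and `χ` its
quadratic character, `t_i = w` if `p ∣ i`, `t_i = u` if `p ∤ i` and `χ(i) = χ(b)`, and `t_i = v`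
otherwise (for `b ≠ 0` this is the case `p ∤ i`, `χ(i) = -χ(b)`). -/
def quadCyclePoly {F : Type*} [Field F] [Fintype F] [DecidableEq F] (k : ℕ) (b : F)
    (u v w : ℂ) : ℂ :=
  cyclePoly k fun i =>
    if ringChar F ∣ i then w
    else if quadraticChar F (i : F) = quadraticChar F b then u
    else v

end

/-! Fix a primitive additive character ψ. Orthogonality gives q·N = ∑_a ψ(-ab) S(a), where S(a) sums
∏ ψ(a x_i²) over injective tuples of units (`card_mul_distinctNonzeroSquareSols`). S(a) is k! times
the elementary symmetric function e_k of the values ψ(a x²), so by Newton's identities it is a cycle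
polynomial in their power sums (`sum_embedding_prod_eq_cyclePoly`). The j-th power sum is ∑_x ψ(ja
x²), a quadratic Gauss sum: q - 1 if p ∣ j, else χ(ja)G - 1. Hence for a ≠ 0, S(a) depends only on
χ(ab), and ∑ ψ(-c) = -1 and ∑ ψ(-c)χ(c) = χ(-1)G over units finish the sum; a = 0 gives (q-1)_k.
Only G² = χ(-1)q is needed: the result is invariant under G ↦ -G. -/

/-- The weight `∏ t_i^{c_i} / (i^{c_i} c_i!)` of a cycle type. -/
noncomputable def cycleWeight (k : ℕ) (t : ℕ → ℂ) (c : Fin k → ℕ) : ℂ :=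
  ∏ j : Fin k, t (j.val + 1) ^ c j / (((j.val + 1 : ℕ) : ℂ) ^ c j * ((c j)! : ℂ))

/-- The cycle types of total size `n` with cycle lengths and multiplicities at most `k`. -/
def cycleTypesOfSize (k n : ℕ) : Finset (Fin k → ℕ) :=
  (Fintype.piFinset fun _ : Fin k => Finset.range (k + 1)).filter
    fun c => ∑ j : Fin k, (j.val + 1) * c j = n

theorem mem_cycleTypesOfSize {k n : ℕ} (h : n ≤ k) (c : Fin k → ℕ) :
    c ∈ cycleTypesOfSize k n ↔ ∑ j : Fin k, (j.val + 1) * c j = n := by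
  simp only [cycleTypesOfSize, Finset.mem_filter, Fintype.mem_piFinset, Finset.mem_range,
    and_iff_right_iff_imp]
  intro hc i
  have := Finset.single_le_sum (f := fun j : Fin k => (j.val + 1) * c j)
    (fun _ _ => Nat.zero_le _) (Finset.mem_univ i)
  simp only [hc] at this
  nlinarith

/-- The normalized cycle polynomial of degree `n`, in the variables `t_1, …, t_k`. -/
noncomputable def cycleTypeSum (k n : ℕ) (t : ℕ → ℂ) : ℂ :=
  ∑ c ∈ cycleTypesOfSize k n, cycleWeight k t c

theorem cyclePoly_eq (k : ℕ) (t : ℕ → ℂ) : cyclePoly k t = k ! * cycleTypeSum k k t := by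
  rw [cyclePoly, cycleTypeSum, Finset.mul_sum]
  refine Finset.sum_congr rfl fun c _ => ?_
  rw [cycleTypeCount, cycleWeight, Finset.prod_div_distrib]
  ring

/-! ### Cycle polynomials and Newton's identities -/

theorem cycleWeight_add_single (k : ℕ) (t : ℕ → ℂ) (d : Fin k → ℕ) (i : Fin k) :
    ((i.val + 1 : ℕ) : ℂ) * ((d i + 1 : ℕ) : ℂ) * cycleWeight k t (d + Pi.single i 1) =
      t (i.val + 1) * cycleWeight k t d := by
  have h1 : ((i.val + 1 : ℕ) : ℂ) ≠ 0 := Nat.cast_ne_zero.mpr (by omega)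
  have h2 : ((d i + 1 : ℕ) : ℂ) ≠ 0 := Nat.cast_ne_zero.mpr (by omega)
  have h3 : ((d i)! : ℂ) ≠ 0 := Nat.cast_ne_zero.mpr (Nat.factorial_ne_zero _)
  rw [cycleWeight, cycleWeight, ← Finset.mul_prod_erase _ _ (Finset.mem_univ i),
    ← Finset.mul_prod_erase _ _ (Finset.mem_univ i)]
  have h4 : ∏ j ∈ Finset.univ.erase i, t (j.val + 1) ^ (d + Pi.single i 1 : Fin k → ℕ) j /
        (((j.val + 1 : ℕ) : ℂ) ^ (d + Pi.single i 1 : Fin k → ℕ) j * (((d + Pi.single i 1 : Fin k → ℕ) j)! : ℂ)) =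
      ∏ j ∈ Finset.univ.erase i, t (j.val + 1) ^ d j /
        (((j.val + 1 : ℕ) : ℂ) ^ d j * ((d j)! : ℂ)) := by
    refine Finset.prod_congr rfl fun j hj => ?_
    simp [Pi.single_eq_of_ne (Finset.ne_of_mem_erase hj)]
  rw [h4]
  simp only [Pi.add_apply, Pi.single_eq_same, Nat.factorial_succ, pow_succ, Nat.cast_mul]
  field_simp

theorem sum_add_single (k : ℕ) (d : Fin k → ℕ) (i : Fin k) :
    ∑ j : Fin k, (j.val + 1) * (d + Pi.single i 1 : Fin k → ℕ) j =
      ∑ j : Fin k, (j.val + 1) * d j + (i.val + 1) := by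
  simp [mul_add, Finset.sum_add_distrib, Pi.single_apply]

/-- Removing one cycle of length i + 1 leaves a cycle type of smaller size; summing over i yields
the Newton recursion. -/
theorem sum_cycleTypesOfSize_mul (k n : ℕ) (hn : n ≤ k) (t : ℕ → ℂ) (i : Fin k) :
    ∑ c ∈ cycleTypesOfSize k n, ((i.val + 1 : ℕ) : ℂ) * (c i : ℂ) * cycleWeight k t c =
      if i.val + 1 ≤ n then t (i.val + 1) * cycleTypeSum k (n - (i.val + 1)) t else 0 := by
  split_ifs with h
  · rw [cycleTypeSum, Finset.mul_sum]
    symm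
    -- Types with c i = 0 are not of the form d + e_i, but the factor c i kills them.
    refine Finset.sum_bij_ne_zero (fun d _ _ => d + Pi.single i 1) ?_ ?_ ?_ ?_
    · intro d hd _
      rw [mem_cycleTypesOfSize (by omega)] at hd
      rw [mem_cycleTypesOfSize hn, sum_add_single, hd]
      omega
    · intro d _ _ d' _ _ hdd
      exact add_right_cancel hdd
    · intro c hc hne
      have hci : c i ≠ 0 := by
        intro h0
        simp [h0] at hne
      have hcd : c - Pi.single i 1 + Pi.single i 1 = c := by
        funext j
        by_cases hj : j = i
        · subst hj
          simp
          omega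
        · simp [Pi.single_eq_of_ne hj]
      refine ⟨c - Pi.single i 1, ?_, ?_, hcd⟩
      · rw [mem_cycleTypesOfSize hn, ← hcd, sum_add_single] at hc
        rw [mem_cycleTypesOfSize (by omega)]
        omega
      · rw [← cycleWeight_add_single, hcd]
        have h1 : (c - Pi.single i 1 : Fin k → ℕ) i + 1 = c i := by
          simp
          omega
        rwa [h1]
    · intro d _ _
      rw [← cycleWeight_add_single]
      simp
  · refine Finset.sum_eq_zero fun c hc => ?_
    rw [mem_cycleTypesOfSize hn] at hc
    have := Finset.single_le_sum (f := fun j : Fin k => (j.val + 1) * c j)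
      (fun _ _ => Nat.zero_le _) (Finset.mem_univ i)
    simp only [hc] at this
    have h0 : c i = 0 := by
      by_contra h0
      have : 1 ≤ c i := by omega
      nlinarith
    simp [h0]

/-- Matches the index set of `MvPolynomial.mul_esymm_eq_sum`. -/
theorem sum_fin_eq_sum_antidiagonal (k n : ℕ) (hn : n ≤ k) (f : ℕ → ℕ → ℂ) :
    (∑ i : Fin k, if i.val + 1 ≤ n then f (n - (i.val + 1)) (i.val + 1) else 0) =
      ∑ a ∈ Finset.HasAntidiagonal.antidiagonal n with a.1 < n, f a.1 a.2 := by
  rw [← Finset.sum_filter]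
  refine Finset.sum_bij (fun i _ => (n - (i.val + 1), i.val + 1)) ?_ ?_ ?_ ?_
  · intro i hi
    simp only [Finset.mem_filter, Finset.mem_univ, true_and, Finset.HasAntidiagonal.mem_antidiagonal] at hi ⊢
    omega
  · intro i _ j _ h
    simp only [Prod.mk.injEq] at h
    exact Fin.ext (by omega)
  · rintro ⟨a, b⟩ h
    simp only [Finset.mem_filter, Finset.HasAntidiagonal.mem_antidiagonal] at h
    refine ⟨⟨b - 1, by omega⟩, ?_, ?_⟩
    · simp only [Finset.mem_filter, Finset.mem_univ, true_and]
      omega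
    · simp only [Prod.mk.injEq]
      omega
  · intros
    rfl

theorem mul_cycleTypeSum (k n : ℕ) (hn : n ≤ k) (t : ℕ → ℂ) :
    (n : ℂ) * cycleTypeSum k n t =
      ∑ a ∈ Finset.HasAntidiagonal.antidiagonal n with a.1 < n, t a.2 * cycleTypeSum k a.1 t := by
  rw [← sum_fin_eq_sum_antidiagonal k n hn fun a b => t b * cycleTypeSum k a t]
  simp only [← sum_cycleTypesOfSize_mul k n hn t]
  rw [Finset.sum_comm, cycleTypeSum, Finset.mul_sum]
  refine Finset.sum_congr rfl fun c hc => ?_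
  rw [mem_cycleTypesOfSize hn] at hc
  rw [← Finset.sum_mul, ← hc]
  push_cast
  rfl

theorem cycleTypeSum_zero (k : ℕ) (t : ℕ → ℂ) : cycleTypeSum k 0 t = 1 := by
  have : cycleTypesOfSize k 0 = {0} := by
    ext c
    rw [mem_cycleTypesOfSize (Nat.zero_le _)]
    simp [funext_iff]
  rw [cycleTypeSum, this]
  simp [cycleWeight]

/-- Power sums determine elementary symmetric functions through the cycle polynomials. -/
theorem cycleTypeSum_neg_psum {σ : Type*} [Fintype σ] (f : σ → ℂ) (k n : ℕ) (hn : n ≤ k) :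
    cycleTypeSum k n (fun j => -∑ x, f x ^ j) =
      (-1) ^ n * ∑ A ∈ Finset.powersetCard n (Finset.univ : Finset σ), ∏ x ∈ A, f x := by
  have key : ∀ m, MvPolynomial.aeval f (MvPolynomial.esymm σ ℂ m) =
      ∑ A ∈ Finset.powersetCard m (Finset.univ : Finset σ), ∏ x ∈ A, f x := by
    intro m
    simp [MvPolynomial.esymm]
  rw [← key]
  induction n using Nat.strong_induction_on with
  | _ n ih =>
    rcases Nat.eq_zero_or_pos n with rfl | hpos
    · simp [cycleTypeSum_zero]
    · have hn0 : (n : ℂ) ≠ 0 := Nat.cast_ne_zero.mpr hpos.ne'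
      apply mul_left_cancel₀ hn0
      have newton := congrArg (MvPolynomial.aeval f) (MvPolynomial.mul_esymm_eq_sum σ ℂ n)
      simp only [map_mul, map_natCast, map_pow, map_neg, map_one, map_sum] at newton
      -- The signs (-1)^n and (-1)^(n+1) combine to -1, which is the sign in t_j = -p_j.
      rw [mul_cycleTypeSum k n hn, mul_left_comm, newton, ← mul_assoc, ← pow_add,
        show n + (n + 1) = 2 * n + 1 by ring, pow_succ, pow_mul, neg_one_sq, one_pow, one_mul,
        Finset.mul_sum]
      refine Finset.sum_congr rfl fun a ha => ?_
      rw [Finset.mem_filter] at ha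
      rw [ih a.1 ha.2 (by omega)]
      simp [MvPolynomial.psum]
      ring

/-- Each k-subset is the image of exactly k! embeddings. -/
theorem sum_embedding_prod {σ : Type*} [Fintype σ] [DecidableEq σ] (f : σ → ℂ) (k : ℕ) :
    ∑ x : Fin k ↪ σ, ∏ i, f (x i) =
      k ! * ∑ A ∈ Finset.powersetCard k (Finset.univ : Finset σ), ∏ x ∈ A, f x := by
  rw [← Finset.sum_fiberwise_of_maps_to (s := Finset.univ)
    (t := Finset.powersetCard k (Finset.univ : Finset σ))
    (g := fun x : Fin k ↪ σ => Finset.univ.map x) (by simp), Finset.mul_sum]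
  refine Finset.sum_congr rfl fun A hA => ?_
  rw [Finset.mem_powersetCard] at hA
  have hcard : ({x : Fin k ↪ σ | Finset.univ.map x = A} : Finset _).card = k ! := by
    have hA' : Fintype.card (Fin k) = Fintype.card A := by simp [hA.2]
    rw [← Fintype.card_subtype]
    have e : {x : Fin k ↪ σ // Finset.univ.map x = A} ≃ (Fin k ↪ A) :=
      { toFun := fun x => x.1.codRestrict (A : Set σ) fun i => x.2.subset (by simp)
        invFun := fun y => ⟨y.trans (Function.Embedding.subtype _), by
          apply Finset.eq_of_subset_of_card_le
          · intro z
            simp only [Finset.mem_map, Finset.mem_univ, true_and]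
            rintro ⟨i, rfl⟩
            exact (y i).2
          · simp [hA.2]⟩
        left_inv := fun x => by
          ext
          rfl
        right_inv := fun y => by
          ext
          rfl }
    rw [Fintype.card_congr e, Fintype.card_embedding_eq, ← hA', Fintype.card_fin,
      Nat.descFactorial_self]
  rw [← hcard, ← nsmul_eq_mul, ← Finset.sum_const]
  refine Finset.sum_congr rfl fun x hx => ?_
  rw [Finset.mem_filter] at hx
  rw [← hx.2, Finset.prod_map]

/-- The sum of a product function over injective tuples is a cycle polynomial in the power sums. -/
theorem sum_embedding_prod_eq_cyclePoly {σ : Type*} [Fintype σ] [DecidableEq σ]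
    (f : σ → ℂ) (k : ℕ) :
    ∑ x : Fin k ↪ σ, ∏ i, f (x i) = (-1) ^ k * cyclePoly k (fun j => -∑ x, f x ^ j) := by
  rw [sum_embedding_prod, cyclePoly_eq, cycleTypeSum_neg_psum f k k le_rfl, mul_left_comm,
    ← mul_assoc ((-1 : ℂ) ^ k), ← mul_pow]
  norm_num

theorem addChar_map_sum {F ι : Type*} [Field F] (ψ : AddChar F ℂ) (s : Finset ι) (f : ι → F) :
    ψ (∑ i ∈ s, f i) = ∏ i ∈ s, ψ (f i) := by
  classical
  induction s using Finset.induction_on with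
  | empty => simp
  | insert i s hi ih =>
    rw [Finset.sum_insert hi, Finset.prod_insert hi, AddChar.map_add_eq_mul, ih]

/-! ### Quadratic Gauss sums and character counting -/

section

variable {F : Type*} [Field F] [Fintype F] [DecidableEq F]

theorem sum_eq_zero_add_sum_units (f : F → ℂ) : ∑ a, f a = f 0 + ∑ u : Fˣ, f u := by
  rw [← Finset.add_sum_erase _ _ (Finset.mem_univ (0 : F))]
  congr 1
  symm
  refine Finset.sum_bij (fun u _ => (u : F)) ?_ ?_ ?_ ?_
  · simp
  · intro u _ v _ h
    exact Units.ext h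
  · intro a ha
    exact ⟨Units.mk0 a (Finset.ne_of_mem_erase ha), Finset.mem_univ _, rfl⟩
  · simp

/-- The complex-valued quadratic character. -/
def complexQuadraticChar (F : Type*) [Field F] [Fintype F] [DecidableEq F] : MulChar F ℂ :=
  (quadraticChar F).ringHomComp (Int.castRingHom ℂ)

theorem complexQuadraticChar_apply (a : F) :
    complexQuadraticChar F a = (quadraticChar F a : ℂ) := rfl

theorem complexQuadraticChar_ne_one (hF : ringChar F ≠ 2) : complexQuadraticChar F ≠ 1 :=
  (MulChar.ringHomComp_ne_one_iff Int.cast_injective).mpr (quadraticChar_ne_one hF)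

theorem complexQuadraticChar_inv : (complexQuadraticChar F)⁻¹ = complexQuadraticChar F :=
  ((quadraticChar_isQuadratic F).comp _).inv

theorem gaussSum_complexQuadraticChar_sq (hF : ringChar F ≠ 2) {ψ : AddChar F ℂ}
    (hψ : ψ.IsPrimitive) :
    gaussSum (complexQuadraticChar F) ψ ^ 2 =
      complexQuadraticChar F (-1) * (Fintype.card F : ℂ) :=
  gaussSum_sq (complexQuadraticChar_ne_one hF) ((quadraticChar_isQuadratic F).comp _) hψ

theorem sum_char_mul {ψ : AddChar F ℂ} (c : Fˣ) :
    ∑ a, complexQuadraticChar F a * ψ (c * a) =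
      complexQuadraticChar F c * gaussSum (complexQuadraticChar F) ψ := by
  have := gaussSum_mulShift_eq (complexQuadraticChar F) ψ c
  rwa [complexQuadraticChar_inv] at this

/-- Each y has χ(y) + 1 square roots, and the constant 1 contributes nothing because ψ is
nontrivial. -/
theorem sum_addChar_mul_sq (hF : ringChar F ≠ 2) {ψ : AddChar F ℂ} (hψ : ψ.IsPrimitive) (c : Fˣ) :
    ∑ x : F, ψ (c * x ^ 2) =
      complexQuadraticChar F c * gaussSum (complexQuadraticChar F) ψ := by
  have hfib : ∑ x : F, ψ (c * x ^ 2) =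
      ∑ y : F, (complexQuadraticChar F y + 1) * ψ (c * y) := by
    rw [← Finset.sum_fiberwise Finset.univ (fun x : F => x ^ 2)]
    refine Finset.sum_congr rfl fun y _ => ?_
    have hcard := quadraticChar_card_sqrts hF y
    have hset : ({x : F | x ^ 2 = y} : Set F).toFinset = ({x : F | x ^ 2 = y} : Finset F) := by
      ext x
      simp
    rw [hset] at hcard
    have hcard' : ((({x : F | x ^ 2 = y} : Finset F).card : ℕ) : ℂ) =
        complexQuadraticChar F y + 1 := by
      rw [complexQuadraticChar_apply]
      exact_mod_cast hcard
    rw [← hcard', ← nsmul_eq_mul, ← Finset.sum_const]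
    refine Finset.sum_congr rfl fun x hx => ?_
    rw [(Finset.mem_filter.mp hx).2]
  have hzero : ∑ y : F, ψ (c * y) = 0 := by
    have := AddChar.sum_mulShift (c : F) hψ
    simpa [mul_comm] using this
  rw [hfib]
  simp only [add_mul, one_mul, Finset.sum_add_distrib, hzero, add_zero, sum_char_mul]

theorem sum_units_addChar_mul_sq (hF : ringChar F ≠ 2) {ψ : AddChar F ℂ} (hψ : ψ.IsPrimitive)
    (c : Fˣ) :
    ∑ x : Fˣ, ψ (c * (x : F) ^ 2) =
      complexQuadraticChar F c * gaussSum (complexQuadraticChar F) ψ - 1 := by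
  rw [← sum_addChar_mul_sq hF hψ, sum_eq_zero_add_sum_units (F := F)]
  simp

theorem distinctNonzeroSquareSols_eq (k : ℕ) (b : F) :
    distinctNonzeroSquareSols F k b =
      Fintype.card {x : Fin k ↪ Fˣ // ∑ i, (x i : F) ^ 2 = b} := by
  rw [distinctNonzeroSquareSols, ← Nat.card_eq_fintype_card]
  refine Nat.card_congr
    { toFun := fun x => ⟨⟨fun i => Units.mk0 (x.1 i) (x.2.1 i), fun i j h =>
          x.2.2.1 (congrArg Units.val h)⟩, x.2.2.2⟩
      invFun := fun y => ⟨fun i => (y.1 i : F), fun i => (y.1 i).ne_zero, fun i j h =>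
          y.1.injective (Units.ext h), y.2⟩
      left_inv := fun x => rfl
      right_inv := fun y => by
        ext
        rfl }

theorem card_mul_distinctNonzeroSquareSols {ψ : AddChar F ℂ} (hψ : ψ.IsPrimitive)
    (k : ℕ) (b : F) :
    (Fintype.card F : ℂ) * distinctNonzeroSquareSols F k b =
      ∑ a : F, ψ (-(a * b)) * ∑ x : Fin k ↪ Fˣ, ∏ i, ψ (a * (x i : F) ^ 2) := by
  have h : ∀ x : Fin k ↪ Fˣ,
      ∑ a : F, ψ (-(a * b)) * ∏ i, ψ (a * (x i : F) ^ 2) =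
        if ∑ i, (x i : F) ^ 2 = b then (Fintype.card F : ℂ) else 0 := by
    intro x
    have hs := AddChar.sum_mulShift (∑ i, (x i : F) ^ 2 - b) hψ
    simp only [sub_eq_zero] at hs
    rw [Nat.cast_ite, Nat.cast_zero] at hs
    rw [← hs]
    refine Finset.sum_congr rfl fun a _ => ?_
    rw [← addChar_map_sum, ← AddChar.map_add_eq_mul, ← Finset.mul_sum]
    congr 1
    ring
  simp only [Finset.mul_sum]
  rw [Finset.sum_comm]
  simp only [h]
  rw [← Finset.sum_filter, Finset.sum_const, nsmul_eq_mul, distinctNonzeroSquareSols_eq,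
    Fintype.card_subtype, mul_comm]

theorem neg_sum_units_addChar_pow (hF : ringChar F ≠ 2) {ψ : AddChar F ℂ} (hψ : ψ.IsPrimitive)
    (a b : Fˣ) (j : ℕ) :
    -∑ x : Fˣ, ψ (a * (x : F) ^ 2) ^ j =
      if ringChar F ∣ j then 1 - (Fintype.card F : ℂ)
      else if quadraticChar F (j : F) = quadraticChar F (b : F) then
        1 - complexQuadraticChar F (a * b) * gaussSum (complexQuadraticChar F) ψ
      else 1 + complexQuadraticChar F (a * b) * gaussSum (complexQuadraticChar F) ψ := by
  have hpow : ∀ x : Fˣ, ψ (a * (x : F) ^ 2) ^ j = ψ ((j : F) * a * (x : F) ^ 2) := by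
    intro x
    rw [← AddChar.map_nsmul_eq_pow, nsmul_eq_mul, mul_assoc]
  simp only [hpow]
  split_ifs with h1 h2
  · have hj : (j : F) = 0 := (ringChar.spec F j).mpr h1
    have hpos : 1 ≤ Fintype.card F := Fintype.card_pos
    simp [hj, Fintype.card_units, Nat.cast_sub hpos]
  all_goals
    have hj : (j : F) ≠ 0 := fun h => h1 ((ringChar.spec F j).mp h)
    have hsum := sum_units_addChar_mul_sq hF hψ (Units.mk0 (j : F) hj * a)
    rw [Units.val_mul, Units.val_mk0] at hsum
    rw [hsum, map_mul, map_mul]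
  · rw [complexQuadraticChar_apply (j : F), h2, ← complexQuadraticChar_apply]
    ring
  -- Both values are ±1, so unequal means opposite.
  · have h3 : quadraticChar F (j : F) = -quadraticChar F (b : F) := by
      rcases quadraticChar_dichotomy hj with h | h <;>
        rcases quadraticChar_dichotomy b.ne_zero with h' | h' <;> simp_all
    rw [complexQuadraticChar_apply (j : F), h3, Int.cast_neg, ← complexQuadraticChar_apply]
    ring

theorem sum_embedding_addChar (hF : ringChar F ≠ 2) {ψ : AddChar F ℂ} (hψ : ψ.IsPrimitive)
    (a b : Fˣ) (k : ℕ) :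
    ∑ x : Fin k ↪ Fˣ, ∏ i, ψ (a * (x i : F) ^ 2) =
      (-1) ^ k * quadCyclePoly k (b : F)
        (1 - complexQuadraticChar F (a * b) * gaussSum (complexQuadraticChar F) ψ)
        (1 + complexQuadraticChar F (a * b) * gaussSum (complexQuadraticChar F) ψ)
        (1 - (Fintype.card F : ℂ)) := by
  rw [sum_embedding_prod_eq_cyclePoly (fun x : Fˣ => ψ (a * (x : F) ^ 2)), quadCyclePoly]
  simp only [neg_sum_units_addChar_pow hF hψ a b]

/-- A sum over units weighted by an additive character, of a function of the quadratic character. -/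
theorem sum_units_addChar_mul {ψ : AddChar F ℂ} (hψ : ψ.IsPrimitive) (b : Fˣ) (A : ℂ → ℂ) :
    ∑ a : Fˣ, ψ (-(a * b : F)) * A (complexQuadraticChar F (a * b)) =
      -((1 - complexQuadraticChar F (-1) * gaussSum (complexQuadraticChar F) ψ) * A 1 +
        (1 + complexQuadraticChar F (-1) * gaussSum (complexQuadraticChar F) ψ) * A (-1)) / 2 := by
  -- Any function on {1, -1} is affine.
  have hA : ∀ a : Fˣ, A (complexQuadraticChar F a) =
      (A 1 + A (-1)) / 2 + complexQuadraticChar F a * ((A 1 - A (-1)) / 2) := by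
    intro a
    rcases quadraticChar_dichotomy a.ne_zero with h | h <;>
      rw [complexQuadraticChar_apply, h] <;> push_cast <;> ring
  have hshift : ∑ a : Fˣ, ψ (-(a * b : F)) * A (complexQuadraticChar F (a * b)) =
      ∑ c : Fˣ, ψ (-(c : F)) * A (complexQuadraticChar F c) :=
    Fintype.sum_bijective (fun a => a * b) (Group.mulRight_bijective b) _ _ fun a => by
      rw [Units.val_mul]
  have h1 : ∑ c : Fˣ, ψ (-(c : F)) = -1 := by
    have h := AddChar.sum_mulShift (-1 : F) hψ
    rw [sum_eq_zero_add_sum_units] at h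
    simp at h
    linear_combination h
  have h2 : ∑ c : Fˣ, ψ (-(c : F)) * complexQuadraticChar F c =
      complexQuadraticChar F (-1) * gaussSum (complexQuadraticChar F) ψ := by
    have h := sum_char_mul (F := F) (ψ := ψ) (-1)
    rw [sum_eq_zero_add_sum_units] at h
    rw [MulChar.map_zero, zero_mul, zero_add] at h
    simpa [mul_comm] using h
  rw [hshift]
  simp only [hA, mul_add, Finset.sum_add_distrib, ← mul_assoc, ← Finset.sum_mul, h1, h2]
  ring

theorem card_mul_distinctNonzeroSquareSols_eq (hF : ringChar F ≠ 2) {ψ : AddChar F ℂ}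
    (hψ : ψ.IsPrimitive) (k : ℕ) (b : Fˣ) (G e : ℂ)
    (hG : G = gaussSum (complexQuadraticChar F) ψ) (he : e = complexQuadraticChar F (-1)) :
    (Fintype.card F : ℂ) * distinctNonzeroSquareSols F k (b : F) =
      (descPochhammer ℂ k).eval ((Fintype.card F : ℂ) - 1) - (-1) ^ k / 2 *
        ((1 - e * G) * quadCyclePoly k (b : F) (1 - G) (1 + G) (1 - (Fintype.card F : ℂ)) +
          (1 + e * G) * quadCyclePoly k (b : F) (1 + G) (1 - G) (1 - (Fintype.card F : ℂ))) := by
  have hpos : 1 ≤ Fintype.card F := Fintype.card_pos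
  have hdesc : (descPochhammer ℂ k).eval ((Fintype.card F : ℂ) - 1) =
      ((Fintype.card F - 1).descFactorial k : ℂ) := by
    rw [← descPochhammer_eval_eq_descFactorial, Nat.cast_sub hpos, Nat.cast_one]
  have hunits := sum_units_addChar_mul hψ b fun z =>
    (-1) ^ k * quadCyclePoly k (b : F) (1 - z * G) (1 + z * G) (1 - (Fintype.card F : ℂ))
  simp only [hG] at hunits
  rw [card_mul_distinctNonzeroSquareSols hψ, sum_eq_zero_add_sum_units]
  simp only [sum_embedding_addChar hF hψ _ b]
  rw [hunits, hdesc, hG, he]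
  -- At a = 0 every factor is 1, so the term counts embeddings into the q - 1 units.
  simp [Fintype.card_embedding_eq, Fintype.card_units, ← sub_eq_add_neg]
  ring

end

theorem distinctNonzeroSquareSols_eq_of_sq {F : Type*} [Field F] [Fintype F] [DecidableEq F]
    (hF : ringChar F ≠ 2) (k : ℕ) (b : Fˣ) (e g : ℂ) (he : complexQuadraticChar F (-1) = e)
    (hg : g ^ 2 = e * (Fintype.card F : ℂ)) :
    (distinctNonzeroSquareSols F k (b : F) : ℂ) =
      (descPochhammer ℂ k).eval ((Fintype.card F : ℂ) - 1) / (Fintype.card F : ℂ) -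
        (-1 : ℂ) ^ k / (2 * (Fintype.card F : ℂ)) *
        ((1 - e * g) * quadCyclePoly k (b : F) (1 - g) (1 + g) (1 - (Fintype.card F : ℂ)) +
          (1 + e * g) * quadCyclePoly k (b : F) (1 + g) (1 - g) (1 - (Fintype.card F : ℂ))) := by
  have hψ := AddChar.FiniteField.primitiveChar_to_Complex_isPrimitive F
  have hq0 : (Fintype.card F : ℂ) ≠ 0 := Nat.cast_ne_zero.mpr Fintype.card_ne_zero
  have main := card_mul_distinctNonzeroSquareSols_eq hF hψ k b _ e rfl he.symm
  have hsq := gaussSum_complexQuadraticChar_sq hF hψ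
  rw [he, ← hg] at hsq
  apply mul_left_cancel₀ hq0
  -- The Gauss sum is g or -g; the second case merely swaps the two summands.
  rcases sq_eq_sq_iff_eq_or_eq_neg.mp hsq with h | h
  · rw [main, h]
    field_simp
  · rw [main, h]
    simp only [mul_neg, sub_neg_eq_add, ← sub_eq_add_neg]
    field_simp
    ring

theorem theorem4p3 {F : Type*} [Field F] [Fintype F] [DecidableEq F]
    (p s q : ℕ) (hp : p.Prime) (hp_odd : Odd p) (hs : 1 ≤ s) (hq : q = p ^ s)
    (hF : Fintype.card F = q) (k : ℕ) (hk : 1 ≤ k) (b : F) (hb : b ≠ 0) :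
    ((p % 4 = 1 ∨ (p % 4 = 3 ∧ Even s)) →
      (distinctNonzeroSquareSols F k b : ℂ) =
        (descPochhammer ℂ k).eval ((q : ℂ) - 1) / (q : ℂ) -
          (-1 : ℂ) ^ k / (2 * (q : ℂ)) *
            ((1 - (Real.sqrt q : ℂ)) *
                quadCyclePoly k b (1 - (Real.sqrt q : ℂ)) (1 + (Real.sqrt q : ℂ)) (1 - (q : ℂ)) +
              (1 + (Real.sqrt q : ℂ)) *
                quadCyclePoly k b (1 + (Real.sqrt q : ℂ)) (1 - (Real.sqrt q : ℂ)) (1 - (q : ℂ)))) ∧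
    ((p % 4 = 3 ∧ Odd s) →
      (distinctNonzeroSquareSols F k b : ℂ) =
        (descPochhammer ℂ k).eval ((q : ℂ) - 1) / (q : ℂ) -
          (-1 : ℂ) ^ k / (2 * (q : ℂ)) *
            ((1 + (Real.sqrt q : ℂ) * Complex.I) *
                quadCyclePoly k b (1 - (Real.sqrt q : ℂ) * Complex.I)
                  (1 + (Real.sqrt q : ℂ) * Complex.I) (1 - (q : ℂ)) +
              (1 - (Real.sqrt q : ℂ) * Complex.I) *
                quadCyclePoly k b (1 + (Real.sqrt q : ℂ) * Complex.I)
                  (1 - (Real.sqrt q : ℂ) * Complex.I) (1 - (q : ℂ)))) := by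
  have hp2 : p ≠ 2 := by
    rintro rfl
    exact absurd hp_odd (by decide)
  have hchar : ringChar F = p := by
    have := Fact.mk hp
    have : CharP F p := charP_of_card_eq_prime_pow (hF.trans hq)
    exact ringChar.eq F p
  have hF2 : ringChar F ≠ 2 := hchar.trans_ne hp2
  have hq4 : (quadraticChar F (-1) : ℤ) = ZMod.χ₄ (q : ℕ) := by
    rw [quadraticChar_neg_one hF2, hF]
  have hsqrt : (Real.sqrt q : ℂ) ^ 2 = q := by
    rw [← Complex.ofReal_pow, Real.sq_sqrt (Nat.cast_nonneg q), Complex.ofReal_natCast]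
  constructor
  · intro h
    have hmod : q % 4 = 1 := by
      rw [hq, Nat.pow_mod]
      rcases h with h | ⟨h, r, rfl⟩
      · simp [h]
      · rw [h, ← two_mul, pow_mul, Nat.pow_mod]
        simp
    have he : complexQuadraticChar F (-1) = 1 := by
      rw [complexQuadraticChar_apply, hq4, ZMod.χ₄_nat_one_mod_four hmod, Int.cast_one]
    have key := distinctNonzeroSquareSols_eq_of_sq hF2 k (Units.mk0 b hb) 1 (Real.sqrt q : ℂ) he
      (by rw [hsqrt, hF, one_mul])
    simpa only [Units.val_mk0, one_mul, hF] using key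
  · rintro ⟨h, r, rfl⟩
    have hmod : q % 4 = 3 := by
      rw [hq, Nat.pow_mod, h, pow_succ, pow_mul, Nat.mul_mod, Nat.pow_mod]
      simp
    have he : complexQuadraticChar F (-1) = -1 := by
      rw [complexQuadraticChar_apply, hq4, ZMod.χ₄_nat_three_mod_four hmod, Int.cast_neg,
        Int.cast_one]
    -- Here e = -1, so the outer factors carry the sign opposite to the first argument of
    -- `quadCyclePoly`.
    have key := distinctNonzeroSquareSols_eq_of_sq hF2 k (Units.mk0 b hb) (-1)
      (Real.sqrt q * Complex.I : ℂ) he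
      (by rw [mul_pow, hsqrt, Complex.I_sq, hF]; ring)
    simpa only [Units.val_mk0, neg_one_mul, sub_neg_eq_add, ← sub_eq_add_neg, hF] using key
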